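/- Let $X_1,\dots,X_N$ be records of $p$ categorical features with class labels $y_1,\dots,y_N$, each record being regarded as the set of its $p$ items "feature $j$ has value $v$". Let $c$ be a class such that $I^{(c)}=\{i: y_i=c\}$ is nonempty, let $s$ be a pattern (a finite set of items), and let $$p_s=\frac{1}{|I^{(c)}|}\sum_{i\in I^{(c)}}\mathbf 1_{\{s\subseteq X_i\}}$$ be the frequency of $s$ in class $c$. Fix $D\ge 1$. For each $M\ge1$ generate $M$ independent random intersection chains of length $D$: for $1\le m\le M$ draw $i_{m,1},\dots,i_{m,D}$ independently and uniformly from $I^{(c)}$ (all draws being independent), and put $S_{1,m}=X_{i_{m,1}}$ and $S_{d,m}=S_{d-1,m}\cap X_{i_{m,d}}$ for $2\le d\le D$. Let $k_{s,m}$ be the largest $d\in\{1,\dots,D\}$ with $s\subseteq S_{d,m}$ (and $k_{s,m}=0$ if there is none), let $\chi_{s,m}=\mathbf 1_{\{k_{s,m}<D\}}$, let $\bar k_s=\frac1M\sum_{m=1}^M k_{s,m}$ and $\bar\chi_s=\frac1M\sum_{m=1}^M\chi_{s,m}$, and let $$\hat p_s=\frac{\bar k_s}{\bar k_s+\bar\chi_s}$$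 be the (maximum-likelihood) estimator of $p_s$ computed from the $M$ chains. Then, as $M\to\infty$, $$\sqrt M\,(\hat p_s-p_s)\ \xrightarrow{\ d\ }\ N\!\left(0,\ \frac{p_s(1-p_s)^2}{1-p_s^D}\right),$$ where for $p_s=1$ the variance is read as its limiting value $0$, and a normal distribution of variance $0$ is the point mass at its mean. -/

import Mathlib

open MeasureTheory ProbabilityTheory Filter

namespace RIC

/-- A record of `p` categorical features (label-encoded by natural numbers). -/
abbrev Record (p : ℕ) := Fin p → ℕ

/-- A finite set of items; the item `(j, v)` stands for "feature `j` has value `v`".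
Patterns (interactions) and the nodes of chains are itemsets. -/
abbrev Itemset (p : ℕ) := Finset (Fin p × ℕ)

/-- The record `x` regarded as the set of its `p` items. -/
def Record.items {p : ℕ} (x : Record p) : Itemset p :=
  Finset.univ.image fun j => (j, x j)

section Data

variable {p N : ℕ} {C : Type*} [DecidableEq C]

/-- The set `I^(c)` of (indices of) observations in class `c`. -/
def classObs (y : Fin N → C) (c : C) : Finset (Fin N) :=
  Finset.univ.filter fun i => y i = c

/-- The frequency `p_s^(c)` of the pattern `s` for class `c`: the proportion of the records
with label `c` that contain `s`. -/
noncomputable def freq (X : Fin N → Record p) (y : Fin N → C) (c : C) (s : Itemset p) : ℝ :=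
  (1 / ((classObs y c).card : ℝ)) *
    ∑ i ∈ classObs y c, if s ⊆ (X i).items then (1 : ℝ) else 0

end Data

section Chains

variable {p D M : ℕ}

/-- The nodes of the chain generated by the drawn records `r 0, …, r (D-1)`: the head node is the
first record, every other node is the previous node intersected with the next record.
The argument is 0-based: `chainNode r d h` is the `(d+1)`-st node. -/
def chainNode (r : Fin D → Record p) : (d : ℕ) → d < D → Itemset p
  | 0, h => (r ⟨0, h⟩).items
  | d + 1, h => chainNode r d (Nat.lt_of_succ_lt h) ∩ (r ⟨d + 1, h⟩).items

/-- The count `k_s` of the chain: the largest (1-based) position of a node that contains `s`,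
and `0` if no node contains `s`. -/
def chainCount (s : Itemset p) (r : Fin D → Record p) : ℕ :=
  (Finset.univ.filter fun d : Fin D => s ⊆ chainNode r d d.isLt).sup fun d => (d : ℕ) + 1

/-- The indicator `χ_s` that the count is less than the length `D` of the chain. -/
def chainInd (s : Itemset p) (r : Fin D → Record p) : ℕ :=
  if chainCount s r < D then 1 else 0

/-- The mean count over `M` chains. -/
noncomputable def meanCount (s : Itemset p) (r : Fin M → Fin D → Record p) : ℝ :=
  (1 / (M : ℝ)) * ∑ m, (chainCount s (r m) : ℝ)

/-- The mean indicator over `M` chains. -/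
noncomputable def meanInd (s : Itemset p) (r : Fin M → Fin D → Record p) : ℝ :=
  (1 / (M : ℝ)) * ∑ m, (chainInd s (r m) : ℝ)

/-- The frequency estimator computed from `M` chains of length `D`; `r m d` is the record
drawn in step `d` of chain `m`. -/
noncomputable def freqEstimator (s : Itemset p) (r : Fin M → Fin D → Record p) : ℝ :=
  meanCount s r / (meanCount s r + meanInd s r)

end Chains

end RIC

namespace RIC

/-! ### The count of a single chain. -/

section ChainCount

variable {p D : ℕ}

/-! Write `k`, `χ` for the count and indicator of one chain, and `q` for the frequency. Then `p̂ - q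
= ∑ (k - q (k + χ)) / ∑ (k + χ)`, the sums running over independent chains. Since `P(k > j) = q ^ (j
+ 1)` for `j < D`, summation by parts (`integral_chainCount`) gives `E(k + χ) = a := ∑_{j<D} q ^ j`,
numerator mean `0` and numerator variance `q (1 - q) a`. The central limit theorem above, the law of
large numbers below and Slutsky's theorem yield variance `q (1 - q) / a`, which the geometric sum
turns into the stated one. -/

theorem subset_chainNode_iff (s : Itemset p) (r : Fin D → Record p) (d : ℕ) (h : d < D) :
    s ⊆ chainNode r d h ↔ ∀ e : Fin D, (e : ℕ) ≤ d → s ⊆ (r e).items := by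
  induction d with
  | zero =>
    refine ⟨fun hs e he => ?_, fun hs => hs ⟨0, h⟩ le_rfl⟩
    obtain rfl : e = ⟨0, h⟩ := Fin.ext (by simpa using he)
    exact hs
  | succ d ih =>
    rw [chainNode, Finset.subset_inter_iff, ih]
    refine ⟨fun ⟨h₁, h₂⟩ e he => ?_, fun hs => ⟨fun e he => hs e (by omega), hs _ le_rfl⟩⟩
    rcases Nat.le_succ_iff.1 he with he | he
    · exact h₁ e he
    · obtain rfl : e = ⟨d + 1, h⟩ := Fin.ext he
      exact h₂

theorem lt_chainCount_iff (s : Itemset p) (r : Fin D → Record p) {j : ℕ} (hj : j < D) :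
    j < chainCount s r ↔ ∀ e : Fin D, (e : ℕ) ≤ j → s ⊆ (r e).items := by
  rw [chainCount, Finset.lt_sup_iff]
  simp only [Finset.mem_filter, Finset.mem_univ, true_and, subset_chainNode_iff]
  exact ⟨fun ⟨d, hd, hjd⟩ e he => hd e (by omega), fun h => ⟨⟨j, hj⟩, h, Nat.lt_succ_self j⟩⟩

theorem chainCount_le (s : Itemset p) (r : Fin D → Record p) : chainCount s r ≤ D :=
  Finset.sup_le fun d _ => d.isLt

theorem one_le_chainCount_add_chainInd (hD : 1 ≤ D) (s : Itemset p) (r : Fin D → Record p) :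
    1 ≤ chainCount s r + chainInd s r := by
  unfold chainInd
  split_ifs <;> omega

end ChainCount

/-! ### Law and moments of the count. -/

section Law

variable {p N D : ℕ} {C : Type*} [DecidableEq C]

/-- The law of the indices drawn for one chain of length `D`. -/
noncomputable abbrev chainLaw (y : Fin N → C) (c : C) (D : ℕ) : Measure (Fin D → Fin N) :=
  Measure.pi fun _ => uniformOn (classObs y c : Set (Fin N))

theorem uniformOn_measureReal_eq_freq (X : Fin N → Record p) (y : Fin N → C) (c : C)
    (s : Itemset p) :
    (uniformOn (classObs y c : Set (Fin N))).real {i | s ⊆ (X i).items} = freq X y c s := by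
  have : {i | s ⊆ (X i).items} =
      ((Finset.univ.filter fun i => s ⊆ (X i).items : Finset (Fin N)) : Set (Fin N)) := by
    ext; simp
  rw [this, measureReal_def, uniformOn_apply_finset, freq, Finset.sum_boole, ENNReal.toReal_div,
    Finset.inter_filter, Finset.inter_univ]
  simp
  ring

theorem freq_nonneg (X : Fin N → Record p) (y : Fin N → C) (c : C) (s : Itemset p) :
    0 ≤ freq X y c s := by
  rw [← uniformOn_measureReal_eq_freq]
  exact measureReal_nonneg

theorem isProbabilityMeasure_uniformOn_classObs {y : Fin N → C} {c : C}
    (hc : (classObs y c).Nonempty) :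
    IsProbabilityMeasure (uniformOn (classObs y c : Set (Fin N))) :=
  isProbabilityMeasure_uniformOn (Finset.finite_toSet _) hc

theorem freq_le_one (X : Fin N → Record p) {y : Fin N → C} {c : C}
    (hc : (classObs y c).Nonempty) (s : Itemset p) : freq X y c s ≤ 1 := by
  have := isProbabilityMeasure_uniformOn_classObs hc
  rw [← uniformOn_measureReal_eq_freq]
  exact measureReal_le_one

/-- The event is a product set that constrains only the first `j + 1` draws. -/
theorem chainLaw_measureReal_lt_chainCount (X : Fin N → Record p) {y : Fin N → C} {c : C}
    (hc : (classObs y c).Nonempty) (s : Itemset p) {j : ℕ} (hj : j < D) :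
    (chainLaw y c D).real {w | j < chainCount s fun d => X (w d)} = freq X y c s ^ (j + 1) := by
  have := isProbabilityMeasure_uniformOn_classObs hc
  have hset : {w : Fin D → Fin N | j < chainCount s fun d => X (w d)} =
      Set.univ.pi fun e : Fin D => {i | (e : ℕ) ≤ j → s ⊆ (X i).items} := by
    ext w
    simp [lt_chainCount_iff s _ hj]
  have hfac (e : Fin D) :
      (uniformOn (classObs y c : Set (Fin N))).real {i | (e : ℕ) ≤ j → s ⊆ (X i).items} =
        if e ≤ ⟨j, hj⟩ then freq X y c s else 1 := by
    split_ifs with h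
    · have h' : (e : ℕ) ≤ j := h
      simp only [h', true_imp_iff, uniformOn_measureReal_eq_freq]
    · have h' : ¬ (e : ℕ) ≤ j := h
      simp [h']
  rw [hset, measureReal_def, Measure.pi_pi, ENNReal.toReal_prod]
  simp only [← measureReal_def, hfac, Finset.prod_ite, Finset.prod_const, one_pow, mul_one]
  congr 1
  have : (Finset.univ.filter fun e : Fin D => e ≤ ⟨j, hj⟩) = Finset.Iic ⟨j, hj⟩ := by
    ext; simp
  rw [this, Fin.card_Iic]

/-- Telescope `f k = f 0 + ∑_{j<k} (f (j + 1) - f j)` and integrate the indicators of `j < k`. -/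
theorem integral_chainCount (X : Fin N → Record p) {y : Fin N → C} {c : C}
    (hc : (classObs y c).Nonempty) (s : Itemset p) (f : ℕ → ℝ) :
    ∫ w, f (chainCount s fun d => X (w d)) ∂(chainLaw y c D) =
      f 0 + ∑ j ∈ Finset.range D, (f (j + 1) - f j) * freq X y c s ^ (j + 1) := by
  have := isProbabilityMeasure_uniformOn_classObs hc
  have hf (w : Fin D → Fin N) : f (chainCount s fun d => X (w d)) =
      f 0 + ∑ j ∈ Finset.range D, (f (j + 1) - f j) *
        Set.indicator {w | j < chainCount s fun d => X (w d)} 1 w := by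
    have hk := chainCount_le s fun d => X (w d)
    generalize hkk : (chainCount s fun d => X (w d)) = k at hk
    simp only [Set.indicator_apply, Set.mem_ofPred_eq, hkk, Pi.one_apply, mul_ite, mul_one, mul_zero,
      ← Finset.sum_filter]
    have : (Finset.range D).filter (fun j => j < k) = Finset.range k := by
      ext; simp; omega
    rw [this, Finset.sum_range_sub]
    ring
  simp_rw [hf]
  rw [integral_add .of_finite .of_finite, integral_finsetSum _ fun _ _ => .of_finite]
  simp only [integral_const, probReal_univ, smul_eq_mul, one_mul, integral_const_mul]
  congr 1
  refine Finset.sum_congr rfl fun j hj => ?_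
  rw [integral_indicator_one (Set.toFinite _).measurableSet,
    chainLaw_measureReal_lt_chainCount X hc s (Finset.mem_range.1 hj)]

/-- For `D ≥ 1`, `k + χ = min (k + 1) D`: it starts at `1`, and its last increment vanishes. -/
theorem integral_count_add_ind (X : Fin N → Record p) {y : Fin N → C} {c : C}
    (hc : (classObs y c).Nonempty) (s : Itemset p) :
    ∫ w, ((chainCount s fun d => X (w d) : ℝ) + chainInd s fun d => X (w d)) ∂(chainLaw y c D) =
      ∑ j ∈ Finset.range D, freq X y c s ^ j := by
  have h := integral_chainCount (D := D) X hc s fun k => (k : ℝ) + if k < D then 1 else 0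
  simp only [chainInd, Nat.cast_ite, Nat.cast_one, Nat.cast_zero]
  rw [h]
  cases D with
  | zero => simp
  | succ D =>
    rw [Finset.sum_range_succ, Finset.sum_range_succ', Finset.sum_congr rfl (g := fun j =>
      freq X y c s ^ (j + 1)) fun j hj => ?_]
    · simp
      ring
    · have := Finset.mem_range.1 hj
      rw [if_pos (by omega), if_pos (by omega)]
      push_cast
      ring

theorem integral_count_sub (X : Fin N → Record p) {y : Fin N → C} {c : C}
    (hc : (classObs y c).Nonempty) (s : Itemset p) :
    ∫ w, ((chainCount s fun d => X (w d) : ℝ) - freq X y c s *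
      ((chainCount s fun d => X (w d) : ℝ) + chainInd s fun d => X (w d))) ∂(chainLaw y c D) =
      0 := by
  have := isProbabilityMeasure_uniformOn_classObs hc
  rw [integral_sub .of_finite .of_finite, integral_const_mul, integral_count_add_ind X hc s,
    integral_chainCount X hc s fun k => (k : ℝ), Finset.mul_sum, Nat.cast_zero, zero_add,
    ← Finset.sum_sub_distrib]
  refine Finset.sum_eq_zero fun j _ => ?_
  push_cast
  ring

/-- The integrand `k - q (k + χ)` is `(1 - q) k - q` for `k < D` but `(1 - q) D` at `k = D`.
Separating this top correction from the sum allows induction on `D`. -/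
theorem sum_sq_increments (q : ℝ) (D : ℕ) :
    q ^ 2 + ∑ j ∈ Finset.range D,
        (((1 - q) * ((j + 1 : ℕ) : ℝ) - q) ^ 2 - ((1 - q) * (j : ℝ) - q) ^ 2) * q ^ (j + 1) +
      (((1 - q) * (D : ℝ)) ^ 2 - ((1 - q) * (D : ℝ) - q) ^ 2) * q ^ D =
      q * (1 - q) * ∑ j ∈ Finset.range D, q ^ j := by
  induction D with
  | zero => simp
  | succ D ih =>
    rw [Finset.sum_range_succ, Finset.sum_range_succ, mul_add, ← ih]
    push_cast
    ring

theorem integral_count_sub_sq (X : Fin N → Record p) {y : Fin N → C} {c : C}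
    (hc : (classObs y c).Nonempty) (s : Itemset p) (hD : 1 ≤ D) :
    ∫ w, ((chainCount s fun d => X (w d) : ℝ) - freq X y c s *
      ((chainCount s fun d => X (w d) : ℝ) + chainInd s fun d => X (w d))) ^ 2 ∂(chainLaw y c D) =
      freq X y c s * (1 - freq X y c s) * ∑ j ∈ Finset.range D, freq X y c s ^ j := by
  set q := freq X y c s with hq
  have h := integral_chainCount (D := D) X hc s fun k =>
    ((k : ℝ) - q * ((k : ℝ) + if k < D then 1 else 0)) ^ 2
  simp only [chainInd, Nat.cast_ite, Nat.cast_one, Nat.cast_zero]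
  rw [h, ← sum_sq_increments, ← hq]
  obtain ⟨D, rfl⟩ : ∃ E, D = E + 1 := ⟨D - 1, by omega⟩
  rw [Finset.sum_range_succ, Finset.sum_range_succ, Finset.sum_congr rfl (g := fun j : ℕ =>
    (((1 - q) * ((j + 1 : ℕ) : ℝ) - q) ^ 2 - ((1 - q) * (j : ℝ) - q) ^ 2) * q ^ (j + 1))
    fun j hj => ?_]
  · rw [if_pos (by omega), if_neg (by omega), if_pos (by omega)]
    push_cast
    ring
  · have := Finset.mem_range.1 hj
    rw [if_pos (by omega), if_pos (by omega)]
    push_cast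
    ring

end Law

end RIC

/-! ### Limit theorem for ratios, and transfer between probability spaces. -/

theorem tendstoInDistribution_of_forall_identDistrib {ι Ω' Ω'' E : Type*} {Ω : ι → Type*}
    {mΩ : ∀ i, MeasurableSpace (Ω i)} {μ : (i : ι) → Measure (Ω i)}
    [∀ i, IsProbabilityMeasure (μ i)] {m' : MeasurableSpace Ω'} {μ' : Measure Ω'}
    [IsProbabilityMeasure μ'] {m'' : MeasurableSpace Ω''} {μ'' : Measure Ω''}
    [IsProbabilityMeasure μ''] {mE : MeasurableSpace E} [TopologicalSpace E]
    [OpensMeasurableSpace E] {l : Filter ι} {U : ι → Ω'' → E} {V : (i : ι) → Ω i → E} {Z : Ω' → E}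
    (h : TendstoInDistribution U l Z (fun _ => μ'') μ')
    (hUV : ∀ i, IdentDistrib (U i) (V i) μ'' (μ i)) : TendstoInDistribution V l Z μ μ' where
  forall_aemeasurable i := (hUV i).aemeasurable_snd
  aemeasurable_limit := h.aemeasurable_limit
  tendsto := by
    refine h.tendsto.congr fun i => ?_
    exact Subtype.ext (hUV i).map_eq

/-- The ratio of the averages of a centred function `f` and of a function `t ≥ 1` of independent
identically distributed variables, scaled by the root of the sample size, is asymptotically
normal. -/
theorem tendstoInDistribution_sqrt_mul_sum_div_sum {Ω E : Type*} {mΩ : MeasurableSpace Ω}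
    {P : Measure Ω} [IsProbabilityMeasure P] [Finite E] {mE : MeasurableSpace E}
    [MeasurableSingletonClass E] {μ : Measure E} [IsProbabilityMeasure μ] {W : ℕ → Ω → E}
    (hW : ∀ m, HasLaw (W m) μ P) (hind : iIndepFun W P) {f t : E → ℝ} {a : ℝ} {v : NNReal}
    (hf : ∫ w, f w ∂μ = 0) (ht : ∀ w, 1 ≤ t w) (hta : ∫ w, t w ∂μ = a)
    (hv : ∫ w, f w ^ 2 ∂μ = a ^ 2 * v) :
    TendstoInDistribution
      (fun (M : ℕ) ω => √(M : ℝ) * ((∑ m ∈ Finset.range M, f (W m ω)) /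
        ∑ m ∈ Finset.range M, t (W m ω)))
      atTop (id : ℝ → ℝ) (fun _ => P) (gaussianReal 0 v) := by
  have ha : 1 ≤ a := by
    rw [← hta]
    simpa using integral_mono (μ := μ) (f := fun _ => (1 : ℝ)) .of_finite .of_finite ht
  have mf : Measurable f := measurable_of_finite f
  have mt : Measurable t := measurable_of_finite t
  have mW m : AEMeasurable (W m) P := (hW m).aemeasurable
  have hid m : IdentDistrib (W m) (W 0) P P := (hW m).identDistrib (hW 0)
  have hclt : TendstoInDistribution
      (fun (M : ℕ) ω => (√(M : ℝ))⁻¹ * (∑ m ∈ Finset.range M, f (W m ω)))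
      -- Writing the limit as `a * x` makes the later division by `a` return `id`.
      atTop (fun x : ℝ => a * x) (fun _ => P) (gaussianReal 0 v) := by
    have hE : P[fun ω => f (W 0 ω)] = 0 := by
      rw [← hf]; exact (hW 0).integral_comp mf.aestronglyMeasurable
    have hV : Var[fun ω => f (W 0 ω); P] = a ^ 2 * v := by
      refine (variance_of_integral_eq_zero (mf.comp_aemeasurable (mW 0)) hE).trans ?_
      rw [← hv]
      exact (hW 0).integral_comp (f := fun w => f w ^ 2) (mf.pow_const 2).aestronglyMeasurable
    have hlim : HasLaw (fun x : ℝ => a * x)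
        (gaussianReal 0 Var[fun ω => f (W 0 ω); P].toNNReal) (gaussianReal 0 v) := by
      have := gaussianReal_const_mul (HasLaw.id (μ := gaussianReal 0 v)) a
      convert! this using 2
      · simp
      · rw [hV]
        ext
        simp [mul_nonneg, sq_nonneg]
    have := tendstoInDistribution_inv_sqrt_mul_sum_sub (X := fun m ω => f (W m ω)) hlim
      (MemLp.comp_of_map ((hW 0).map_eq ▸ MemLp.of_discrete) (mW 0))
      (hind.comp (fun _ => f) fun _ => mf) (fun m => (hid m).comp mf)
    simpa [hE] using this
  have hlln : TendstoInMeasure P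
      (fun (M : ℕ) ω => (∑ m ∈ Finset.range M, t (W m ω)) / M) atTop (fun _ => a) := by
    refine tendstoInMeasure_of_tendsto_ae (fun M => ?_) ?_
    · exact (AEMeasurable.div_const (Finset.aemeasurable_fun_sum _ fun m _ =>
        mt.comp_aemeasurable (mW m)) _).aestronglyMeasurable
    · have hE : P[fun ω => t (W 0 ω)] = a := by
        rw [← hta]; exact (hW 0).integral_comp mt.aestronglyMeasurable
      rw [← hE]
      refine strong_law_ae_real (fun m ω => t (W m ω)) ?_
        (fun i j hij => (hind.indepFun hij).comp mt mt) (fun m => (hid m).comp mt)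
      exact Integrable.comp_aemeasurable ((hW 0).map_eq ▸ .of_finite) (mW 0)
  -- The `max` makes the quotient continuous everywhere; it is inactive for `M > 0` and in the
  -- limit, as `t ≥ 1` and `a ≥ 1`.
  have hslut := hclt.continuous_comp_prodMk_of_tendstoInMeasure_const
    (g := fun z : ℝ × ℝ => z.1 / max z.2 1)
    (continuous_fst.div (by fun_prop) fun z => (lt_max_of_lt_right one_pos).ne') hlln
    (fun M => AEMeasurable.div_const (Finset.aemeasurable_fun_sum _ fun m _ =>
        mt.comp_aemeasurable (mW m)) _)
  refine hslut.congr (fun M => .of_forall fun ω => ?_) (.of_forall fun x => ?_)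
  · rcases Nat.eq_zero_or_pos M with rfl | hM
    · simp
    have hM' : (0 : ℝ) < M := Nat.cast_pos.2 hM
    have hT : (M : ℝ) ≤ ∑ m ∈ Finset.range M, t (W m ω) := by
      simpa using Finset.card_nsmul_le_sum (Finset.range M) (fun m => t (W m ω)) 1
        fun m _ => ht _
    have hT' : 0 < ∑ m ∈ Finset.range M, t (W m ω) := hM'.trans_le hT
    have hs : √(M : ℝ) ≠ 0 := (Real.sqrt_pos.2 hM').ne'
    simp only
    rw [max_eq_left ((one_le_div hM').2 hT)]
    field_simp
    rw [Real.sq_sqrt hM'.le, mul_comm]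
  · simp only [max_eq_left ha, id]
    field_simp

/-- The limit theorem needs one infinite sequence on a single space, whereas the given draws live on
a space depending on `M`. -/
theorem exists_iid_vectors {N D : ℕ} (ν : Measure (Fin N)) [IsProbabilityMeasure ν] :
    ∃ (Ω : Type) (_ : MeasurableSpace Ω) (P : Measure Ω) (W : ℕ → Ω → Fin D → Fin N),
      IsProbabilityMeasure P ∧ (∀ m, HasLaw (W m) (Measure.pi fun _ => ν) P) ∧ iIndepFun W P ∧
      (∀ m d, HasLaw (fun ω => W m ω d) ν P) ∧
      iIndepFun (fun (q : ℕ × Fin D) ω => W q.1 ω q.2) P := by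
  obtain ⟨Ω, mΩ, P, W, hm, hW, hind, hP⟩ := exists_iid ℕ (Measure.pi fun _ : Fin D => ν)
  have hlaw (m : ℕ) (d : Fin D) : HasLaw (fun ω => W m ω d) ν P :=
    (measurePreserving_eval (fun _ : Fin D => ν) d).fun_comp_hasLaw (hW m)
  refine ⟨Ω, mΩ, P, W, hP, hW, hind, hlaw, ?_⟩
  exact iIndepFun_uncurry' (X := fun m d ω => W m ω d)
    (fun m d => (measurable_pi_apply d).comp (hm m)) hind
    fun m => (iIndepFun_iff_hasLaw_pi_pi (hlaw m)).2 (hW m)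

theorem RIC.freqEstimator_sub {p D M : ℕ} (hD : 1 ≤ D) (hM : 0 < M) (s : RIC.Itemset p)
    (r : Fin M → Fin D → RIC.Record p) (q : ℝ) :
    RIC.freqEstimator s r - q =
      (∑ m, ((RIC.chainCount s (r m) : ℝ) - q * (RIC.chainCount s (r m) + RIC.chainInd s (r m)))) /
        ∑ m, ((RIC.chainCount s (r m) : ℝ) + RIC.chainInd s (r m)) := by
  have hM' : (0 : ℝ) < M := Nat.cast_pos.2 hM
  have hT : (0 : ℝ) < ∑ m, ((RIC.chainCount s (r m) : ℝ) + RIC.chainInd s (r m)) := by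
    have : Nonempty (Fin M) := ⟨⟨0, hM⟩⟩
    refine Finset.sum_pos (fun m _ => ?_) Finset.univ_nonempty
    exact_mod_cast RIC.one_le_chainCount_add_chainInd hD s (r m)
  rw [RIC.freqEstimator, RIC.meanCount, RIC.meanInd, ← mul_add, ← Finset.sum_add_distrib,
    mul_div_mul_left _ _ (by positivity), Finset.sum_sub_distrib, ← Finset.mul_sum, sub_div,
    mul_div_cancel_right₀ _ hT.ne']

theorem theorem6 {p N : ℕ} {C : Type*} [DecidableEq C]
    -- the data set, a class with at least one observation, and a pattern
    (X : Fin N → RIC.Record p) (y : Fin N → C) (c : C) (hc : (RIC.classObs y c).Nonempty)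
    (s : RIC.Itemset p)
    -- the length of the chains
    (D : ℕ) (hD : 1 ≤ D)
    -- for every number `M` of chains, a probability space that carries the random draws
    (Ω : ℕ → Type*) [∀ M, MeasurableSpace (Ω M)]
    (P : (M : ℕ) → Measure (Ω M)) [∀ M, IsProbabilityMeasure (P M)]
    -- `draw M m d` is the observation drawn in step `d` of chain `m`: the draws are
    -- independent and uniform on the observations in class `c`
    (draw : (M : ℕ) → Fin M → Fin D → Ω M → Fin N)
    (hlaw : ∀ M m d, HasLaw (draw M m d)
      (uniformOn (RIC.classObs y c : Set (Fin N))) (P M))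
    (hindep : ∀ M, iIndepFun (fun q : Fin M × Fin D => draw M q.1 q.2) (P M)) :
    TendstoInDistribution
      (fun (M : ℕ) (ω : Ω M) =>
        √(M : ℝ) * (RIC.freqEstimator s (fun m d => X (draw M m d ω)) - RIC.freq X y c s))
      atTop
      (id : ℝ → ℝ)
      P
      (gaussianReal 0
        (Real.toNNReal (RIC.freq X y c s * (1 - RIC.freq X y c s) ^ 2
          / (1 - RIC.freq X y c s ^ D)))) := by
  have hν := RIC.isProbabilityMeasure_uniformOn_classObs hc
  obtain ⟨Ω', mΩ', P', W, hP', hW, hind, hWlaw, hWind⟩ :=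
    exists_iid_vectors (D := D) (uniformOn (RIC.classObs y c : Set (Fin N)))
  set q := RIC.freq X y c s with hq
  have hq0 : 0 ≤ q := RIC.freq_nonneg X y c s
  have hq1 : q ≤ 1 := RIC.freq_le_one X hc s
  have hvar : q * (1 - q) * ∑ j ∈ Finset.range D, q ^ j = (∑ j ∈ Finset.range D, q ^ j) ^ 2 *
      (Real.toNNReal (q * (1 - q) ^ 2 / (1 - q ^ D)) : ℝ) := by
    have hqD : q ^ D ≤ 1 := pow_le_one₀ hq0 hq1
    rw [Real.coe_toNNReal _ (div_nonneg (by positivity) (by linarith))]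
    rcases hq1.eq_or_lt with h | h
    -- At `q = 1` the quotient is `0 / 0 = 0`, which is the limiting variance.
    · simp [h]
    have hg : (∑ j ∈ Finset.range D, q ^ j) * (1 - q) = 1 - q ^ D := geom_sum_mul_neg q D
    have hpos : 0 < 1 - q ^ D := sub_pos.2 (pow_lt_one₀ hq0 h (by omega))
    rw [← hg] at hpos ⊢
    have h1 : 1 - q ≠ 0 := (sub_pos.2 h).ne'
    have h2 : ∑ j ∈ Finset.range D, q ^ j ≠ 0 := left_ne_zero_of_mul hpos.ne'
    field_simp
  have hmain := tendstoInDistribution_sqrt_mul_sum_div_sum hW hind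
    (RIC.integral_count_sub X hc s)
    (fun w => by exact_mod_cast RIC.one_le_chainCount_add_chainInd hD s fun d => X (w d))
    (RIC.integral_count_add_ind X hc s)
    ((RIC.integral_count_sub_sq X hc s hD).trans hvar)
  refine tendstoInDistribution_of_forall_identDistrib hmain fun M => ?_
  -- Independence and equal marginals determine the joint law of all `M * D` draws, hence that of
  -- the estimator.
  have hdraws : IdentDistrib (fun ω (z : Fin M × Fin D) => W z.1 ω z.2)
      (fun ω z => draw M z.1 z.2 ω) P' (P M) := by
    refine IdentDistrib.pi (fun z => (hWlaw z.1 z.2).identDistrib (hlaw M z.1 z.2)) ?_ (hindep M)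
    exact hWind.precomp (g := fun z : Fin M × Fin D => ((z.1 : ℕ), z.2))
      (Fin.val_injective.prodMap Function.injective_id)
  have := hdraws.comp (measurable_of_finite fun w : Fin M × Fin D → Fin N =>
    √(M : ℝ) * (RIC.freqEstimator s (fun m d => X (w (m, d))) - q))
  convert! this using 1
  funext ω
  rcases Nat.eq_zero_or_pos M with rfl | hM
  · simp
  simp only [Function.comp]
  rw [RIC.freqEstimator_sub hD hM]
  simp only [Finset.sum_range, hq]
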